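/- **Lemma 4.1.** Let $0<\nu\le 1$, $\kappa=\sqrt{1-\nu^2}$, and $$ L_0=\begin{bmatrix} -\tfrac12\partial_{\xi\xi}+\nu^2\,[2-3\,\mathrm{sech}^2(\nu\xi)] & -\kappa\partial_\xi+2\nu\kappa\tanh(\nu\xi)\\[1mm] \kappa\partial_\xi+2\nu\kappa\tanh(\nu\xi) & -\tfrac12\partial_{\xi\xi}-\nu^2\,[2+\mathrm{sech}^2(\nu\xi)]\end{bmatrix}, $$ $$ \sigma_1=\begin{bmatrix}0&1\\1&0\end{bmatrix},\qquad \sigma_2=\begin{bmatrix}0&-i\\ i&0\end{bmatrix},\qquad k_{\rm cutoff}=\sqrt{\nu^2-2+2\sqrt{\nu^4-\nu^2+1}} , $$ where $L_0$ is regarded as an unbounded operator on $L^2(\mathbb R;\mathbb C^2)$ with domain $H^2(\mathbb R;\mathbb C^2)$, and $(Rg)(\xi)=g(-\xi)$. Let $k\in\mathbb C\setminus\{0,\pm k_{\rm cutoff}\}$, let $\Omega_0\in\mathbb C$, and let $0\ne \mathbf f_0\in H^2(\mathbb R;\mathbb C^2)$ satisfy $$ \left(\sigma_2L_0+\tfrac12k^2\sigma_2+\Omega_0\right)\mathbf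 f_0=0 . $$ Suppose that $\Omega_0$ is simple, in the sense that the kernel of $\sigma_2L_0+\tfrac12k^2\sigma_2+\Omega_0$ is one-dimensional (in particular, this holds if the eigenvalue is algebraically simple). Then the kernel of the Hilbert space adjoint is one-dimensional, and $$ \ker\left\{\left(\sigma_2L_0+\tfrac12k^2\sigma_2+\Omega_0\right)^{\dagger}\right\}=\mathrm{span}_{\mathbb C}\{R\,\sigma_1\,\mathbf f_0^{*}\}, $$ where $\mathbf f_0^{*}$ is the entrywise complex conjugate of $\mathbf f_0$. -/

import Mathlib

open MeasureTheory Matrix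
open scoped SchwartzMap ComplexConjugate InnerProductSpace

noncomputable section

namespace DarkSoliton

/-- The value space `ℂ²`, with its Hermitian inner product. -/
abbrev C2 : Type := EuclideanSpace ℂ (Fin 2)

/-- The Hilbert space `L²(ℝ; ℂ²)`. -/
abbrev L2 : Type := Lp C2 2 (volume : Measure ℝ)

/-! ### The Sobolev space `H²(ℝ; ℂ²)` and the weak derivatives -/

/-- The distributional derivative `∂_ξ` of a tempered distribution on `ℝ` with values in `ℂ²`. -/
abbrev distDeriv (u : 𝓢'(ℝ, C2)) : 𝓢'(ℝ, C2) := LineDeriv.lineDerivOp (1 : ℝ) u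

/-- The Sobolev space `H²(ℝ; ℂ²)`, as a subspace of `L²(ℝ; ℂ²)`. -/
def H2 : Submodule ℂ L2 where
  carrier := {f | TemperedDistribution.MemSobolev 2 2 (f : 𝓢'(ℝ, C2))}
  zero_mem' := by
    have e : ((0 : L2) : 𝓢'(ℝ, C2)) = 0 :=
      (Lp.toTemperedDistributionCLM C2 (volume : Measure ℝ) 2).map_zero
    simp [e]
  add_mem' {f g} hf hg := by
    have e : ((f + g : L2) : 𝓢'(ℝ, C2)) = (f : 𝓢'(ℝ, C2)) + (g : 𝓢'(ℝ, C2)) :=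
      (Lp.toTemperedDistributionCLM C2 (volume : Measure ℝ) 2).map_add f g
    simpa [e] using hf.add hg
  smul_mem' c f hf := by
    have e : ((c • f : L2) : 𝓢'(ℝ, C2)) = c • (f : 𝓢'(ℝ, C2)) :=
      (Lp.toTemperedDistributionCLM C2 (volume : Measure ℝ) 2).map_smul c f
    simpa [e] using hf.smul c

theorem toTemperedDistribution_injective {f g : L2}
    (h : (f : 𝓢'(ℝ, C2)) = (g : 𝓢'(ℝ, C2))) : f = g := by
  have hk := Lp.ker_toTemperedDistributionCLM_eq_bot (F := C2) (μ := (volume : Measure ℝ)) (p := 2)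
  exact LinearMap.ker_eq_bot.mp hk h

theorem exists_deriv1 (f : H2) :
    ∃ g : L2, (g : 𝓢'(ℝ, C2)) = distDeriv ((f : L2) : 𝓢'(ℝ, C2)) := by
  have hf : TemperedDistribution.MemSobolev 2 2 ((f : L2) : 𝓢'(ℝ, C2)) := f.2
  have h1 := hf.lineDerivOp (m := (1 : ℝ))
  obtain ⟨g, hg⟩ := TemperedDistribution.memSobolev_zero_iff.mp
    (h1.mono (s' := 0) (by norm_num))
  exact ⟨g, hg.symm⟩

theorem exists_deriv2 (f : H2) :
    ∃ g : L2, (g : 𝓢'(ℝ, C2)) = distDeriv (distDeriv ((f : L2) : 𝓢'(ℝ, C2))) := by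
  have hf : TemperedDistribution.MemSobolev 2 2 ((f : L2) : 𝓢'(ℝ, C2)) := f.2
  have h1 := (hf.lineDerivOp (m := (1 : ℝ))).lineDerivOp (m := (1 : ℝ))
  obtain ⟨g, hg⟩ := TemperedDistribution.memSobolev_zero_iff.mp
    (h1.mono (s' := 0) (by norm_num))
  exact ⟨g, hg.symm⟩

/-- The weak derivative `∂_ξ f ∈ L²` of `f ∈ H²`. -/
def deriv1 (f : H2) : L2 := (exists_deriv1 f).choose

/-- The second weak derivative `∂_ξξ f ∈ L²` of `f ∈ H²`. -/
def deriv2 (f : H2) : L2 := (exists_deriv2 f).choose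

theorem deriv1_spec (f : H2) :
    (deriv1 f : 𝓢'(ℝ, C2)) = distDeriv ((f : L2) : 𝓢'(ℝ, C2)) :=
  (exists_deriv1 f).choose_spec

theorem deriv2_spec (f : H2) :
    (deriv2 f : 𝓢'(ℝ, C2)) = distDeriv (distDeriv ((f : L2) : 𝓢'(ℝ, C2))) :=
  (exists_deriv2 f).choose_spec

theorem coe_add (f g : L2) : ((f + g : L2) : 𝓢'(ℝ, C2)) = (f : 𝓢'(ℝ, C2)) + (g : 𝓢'(ℝ, C2)) :=
  (Lp.toTemperedDistributionCLM C2 (volume : Measure ℝ) 2).map_add f g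

theorem coe_smul (c : ℂ) (f : L2) : ((c • f : L2) : 𝓢'(ℝ, C2)) = c • (f : 𝓢'(ℝ, C2)) :=
  (Lp.toTemperedDistributionCLM C2 (volume : Measure ℝ) 2).map_smul c f

theorem deriv1_add (f g : H2) : deriv1 (f + g) = deriv1 f + deriv1 g := by
  apply toTemperedDistribution_injective
  simp only [coe_add, deriv1_spec, Submodule.coe_add, LineDeriv.lineDerivOp_add]

theorem deriv1_smul (c : ℂ) (f : H2) : deriv1 (c • f) = c • deriv1 f := by
  apply toTemperedDistribution_injective
  simp only [coe_smul, deriv1_spec, Submodule.coe_smul, LineDeriv.lineDerivOp_smul]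

theorem deriv2_add (f g : H2) : deriv2 (f + g) = deriv2 f + deriv2 g := by
  apply toTemperedDistribution_injective
  simp only [coe_add, deriv2_spec, Submodule.coe_add, LineDeriv.lineDerivOp_add]

theorem deriv2_smul (c : ℂ) (f : H2) : deriv2 (c • f) = c • deriv2 f := by
  apply toTemperedDistribution_injective
  simp only [coe_smul, deriv2_spec, Submodule.coe_smul, LineDeriv.lineDerivOp_smul]

/-! ### The operator `L₀` -/

/-- The soliton speed `κ = √(1 - ν²)`. -/
def kappa (ν : ℝ) : ℝ := √(1 - ν ^ 2)

/-- The hyperbolic secant. -/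
def sech (x : ℝ) : ℝ := (Real.cosh x)⁻¹

/-- The cutoff wavenumber `√(ν² - 2 + 2 √(ν⁴ - ν² + 1))`. -/
def kCutoff (ν : ℝ) : ℝ := √(ν ^ 2 - 2 + 2 * √(ν ^ 4 - ν ^ 2 + 1))

/-- The value at `ξ` of the matrix differential operator
`L₀ = [[-½ ∂_ξξ + ν² (2 - 3 sech² νξ), -κ ∂_ξ + 2νκ tanh νξ],
       [κ ∂_ξ + 2νκ tanh νξ, -½ ∂_ξξ - ν² (2 + sech² νξ)]]`
on a function with value `u`, first derivative `u'` and second derivative `u''`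
(as functions on `ℝ`). -/
def L0fun (ν : ℝ) (u u' u'' : ℝ → C2) (ξ : ℝ) : C2 :=
  !₂[(-(1 / 2 : ℂ) * u'' ξ 0 + ((ν ^ 2 * (2 - 3 * sech (ν * ξ) ^ 2) : ℝ) : ℂ) * u ξ 0)
        + (-(kappa ν : ℂ) * u' ξ 1
            + ((2 * ν * kappa ν * Real.tanh (ν * ξ) : ℝ) : ℂ) * u ξ 1),
      ((kappa ν : ℂ) * u' ξ 0
            + ((2 * ν * kappa ν * Real.tanh (ν * ξ) : ℝ) : ℂ) * u ξ 0)
        + (-(1 / 2 : ℂ) * u'' ξ 1 - ((ν ^ 2 * (2 + sech (ν * ξ) ^ 2) : ℝ) : ℂ) * u ξ 1)]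

theorem sech_sq_abs_le (x : ℝ) : |sech x ^ 2| ≤ 1 := by
  have h : 1 ≤ Real.cosh x := Real.one_le_cosh x
  have h0 : 0 ≤ sech x := inv_nonneg.mpr (by linarith)
  have h1 : sech x ≤ 1 := inv_le_one_of_one_le₀ h
  rw [abs_of_nonneg (by positivity)]
  nlinarith

theorem continuous_sech : Continuous sech :=
  Real.continuous_cosh.inv₀ fun x => (Real.cosh_pos x).ne'

theorem continuous_tanh : Continuous Real.tanh := by
  have : Real.tanh = fun x => Real.sinh x / Real.cosh x := funext Real.tanh_eq_sinh_div_cosh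
  rw [this]
  exact Real.continuous_sinh.div Real.continuous_cosh fun x => (Real.cosh_pos x).ne'

theorem memLp_coord (f : L2) (i : Fin 2) : MemLp (fun ξ => f ξ i) 2 (volume : Measure ℝ) :=
  (Lp.memLp f).eval_piLp i

theorem memLp_bdd_mul {a : ℝ → ℝ} (ha : Continuous a) (C : ℝ) (hC : ∀ ξ, |a ξ| ≤ C)
    {v : ℝ → ℂ} (hv : MemLp v 2 (volume : Measure ℝ)) :
    MemLp (fun ξ => (a ξ : ℂ) * v ξ) 2 (volume : Measure ℝ) := by
  refine MemLp.of_le_mul (c := C) hv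
    ((Complex.continuous_ofReal.comp ha).aestronglyMeasurable.mul hv.1) ?_
  filter_upwards with ξ
  rw [norm_mul, Complex.norm_real, Real.norm_eq_abs]
  exact mul_le_mul_of_nonneg_right (hC ξ) (norm_nonneg _)

theorem memLp_L0fun (ν : ℝ) (u u' u'' : L2) :
    MemLp (L0fun ν u u' u'') 2 (volume : Measure ℝ) := by
  have hs : Continuous fun ξ : ℝ => sech (ν * ξ) := continuous_sech.comp (by fun_prop)
  have ht : Continuous fun ξ : ℝ => Real.tanh (ν * ξ) := continuous_tanh.comp (by fun_prop)
  have hT : ∀ i, MemLp (fun ξ => ((2 * ν * kappa ν * Real.tanh (ν * ξ) : ℝ) : ℂ) * u ξ i) 2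
      (volume : Measure ℝ) := fun i =>
    memLp_bdd_mul (by fun_prop) |2 * ν * kappa ν|
      (fun ξ => by
        rw [abs_mul]
        exact mul_le_of_le_one_right (abs_nonneg _) (Real.abs_tanh_lt_one _).le)
      (memLp_coord u i)
  rw [memLp_piLp_iff]
  intro i
  fin_cases i
  · refine MemLp.add (MemLp.add ((memLp_coord u'' 0).const_mul _) ?_)
      (MemLp.add ((memLp_coord u' 1).const_mul _) (hT 1))
    refine memLp_bdd_mul (by fun_prop) (ν ^ 2 * 5) (fun ξ => ?_) (memLp_coord u 0)
    rw [abs_mul, abs_of_nonneg (sq_nonneg ν)]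
    have := abs_le.mp (sech_sq_abs_le (ν * ξ))
    exact mul_le_mul_of_nonneg_left (abs_le.mpr ⟨by linarith, by linarith⟩) (sq_nonneg ν)
  · refine MemLp.add (MemLp.add ((memLp_coord u' 0).const_mul _) (hT 0))
      (MemLp.sub ((memLp_coord u'' 1).const_mul _) ?_)
    refine memLp_bdd_mul (by fun_prop) (ν ^ 2 * 5) (fun ξ => ?_) (memLp_coord u 1)
    rw [abs_mul, abs_of_nonneg (sq_nonneg ν)]
    have := abs_le.mp (sech_sq_abs_le (ν * ξ))
    exact mul_le_mul_of_nonneg_left (abs_le.mpr ⟨by linarith, by linarith⟩) (sq_nonneg ν)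

/-- The unbounded operator `L₀` on `L²(ℝ; ℂ²)`, with domain `H²(ℝ; ℂ²)`. -/
def L0 (ν : ℝ) : L2 →ₗ.[ℂ] L2 where
  domain := H2
  toFun :=
    { toFun := fun f => (memLp_L0fun ν (f : L2) (deriv1 f) (deriv2 f)).toLp
      map_add' := fun f g => by
        rw [← MemLp.toLp_add, MemLp.toLp_eq_toLp_iff, deriv1_add, deriv2_add]
        filter_upwards [Lp.coeFn_add (f : L2) (g : L2), Lp.coeFn_add (deriv1 f) (deriv1 g),
          Lp.coeFn_add (deriv2 f) (deriv2 g)] with ξ h0 h1 h2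
        ext i
        fin_cases i <;>
          simp only [L0fun, Submodule.coe_add, h0, h1, h2, Pi.add_apply, PiLp.add_apply,
            Fin.zero_eta, Fin.mk_one, Matrix.cons_val_zero, Matrix.cons_val_one] <;> ring
      map_smul' := fun c f => by
        rw [RingHom.id_apply, ← MemLp.toLp_const_smul, MemLp.toLp_eq_toLp_iff, deriv1_smul,
          deriv2_smul]
        filter_upwards [Lp.coeFn_smul c (f : L2), Lp.coeFn_smul c (deriv1 f),
          Lp.coeFn_smul c (deriv2 f)] with ξ h0 h1 h2
        ext i
        fin_cases i <;>
          simp only [L0fun, Submodule.coe_smul, h0, h1, h2, Pi.smul_apply, PiLp.smul_apply,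
            smul_eq_mul, Fin.zero_eta, Fin.mk_one, Matrix.cons_val_zero,
            Matrix.cons_val_one] <;> ring }

/-! ### Pauli matrices, reflection, complex conjugation -/

/-- The Pauli matrix `σ₁`. -/
def sigma1 : Matrix (Fin 2) (Fin 2) ℂ := !![0, 1; 1, 0]

/-- The Pauli matrix `σ₂`. -/
def sigma2 : Matrix (Fin 2) (Fin 2) ℂ := !![0, -Complex.I; Complex.I, 0]

/-- A constant `2 × 2` matrix, acting pointwise on `L²(ℝ; ℂ²)`. -/
def matrixOp (A : Matrix (Fin 2) (Fin 2) ℂ) : L2 →L[ℂ] L2 :=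
  (Matrix.toEuclideanCLM (𝕜 := ℂ) A).compLpL 2 (volume : Measure ℝ)

/-- The reflection `(R g)(ξ) = g(-ξ)` on `L²(ℝ; ℂ²)`. -/
def reflect (g : L2) : L2 :=
  Lp.compMeasurePreserving (fun ξ : ℝ => -ξ) (Measure.measurePreserving_neg volume) g

/-- Entrywise complex conjugation on `ℂ²`. -/
def conjC2 : C2 →SL[starRingEnd ℂ] C2 where
  toFun v := WithLp.toLp 2 fun i => conj (v i)
  map_add' v w := by ext i; simp
  map_smul' c v := by ext i; simp
  cont := by fun_prop

/-- Complex conjugation `f ↦ f*` on `L²(ℝ; ℂ²)`. -/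
def conjL2 (f : L2) : L2 := conjC2.compLp f

/-! ### The operator `σ₂ L₀ + ½ k² σ₂ + Ω` and kernels -/

/-- The unbounded operator `σ₂ L₀ + ½ k² σ₂ + Ω` on `L²(ℝ; ℂ²)`, with domain `H²(ℝ; ℂ²)`. -/
def eigenOp (ν : ℝ) (k Ω : ℂ) : L2 →ₗ.[ℂ] L2 :=
  ((1 / 2 * k ^ 2) • (matrixOp sigma2 : L2 →ₗ[ℂ] L2) + Ω • LinearMap.id)
    +ᵥ (matrixOp sigma2 : L2 →ₗ[ℂ] L2).compPMap (L0 ν)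

/-- The kernel of an unbounded operator, as a subspace of the ambient space. -/
def kernel (T : L2 →ₗ.[ℂ] L2) : Submodule ℂ L2 := (LinearMap.ker T.toFun).map T.domain.subtype

end DarkSoliton

end

/-!
Write `T = σ₂ L₀ + ½ k² σ₂ + Ω`. Since `σ₂ [[0, -κ], [κ, 0]] = -iκ`, it has the form `T f = -½ σ₂
f'' - iκ f' + C f` on `H²`, where `C` multiplies by a bounded matrix function (`eigenFun`,
`eigenOp_apply`). Let `J f = R σ₁ f*`, an antiunitary involution of `L²` which preserves `H²`,
commutes with `σ₂`, and anticommutes with `∂_ξ`. The matrix of `C` satisfies `C(ξ)ᵀ σ₁ = σ₁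
C(-ξ)`, which says that `C† J = J C` (`inner_potential_conjReflect`). Integrating by parts in the
other two terms gives `⟪T f, J u⟫ = ⟪f, J (T u)⟫` for `f, u ∈ H²` (`inner_eigenFun_conjReflect`),
so `J` maps `ker T` into `ker T†`.

For the converse inclusion an element `g` of `ker T†`, which is a priori only an `L²` function
orthogonal to the range of `T`, has to be in `H²` (`mem_H2_of_orthogonal`). Testing with Schwartz
functions shows that `∂_ξξ (σ₂ g) = -2iκ ∂_ξ g + 2 C† g` as distributions; this and the regularity
of `∂_ξξ` in the scale `H^s` (`memSobolev_add_two`) raise `g` from `L²` to `H¹` to `H²`. Then `0 =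
⟪T f, g⟫ = ⟪f, J (T (J g))⟫` for all `f` in the dense subspace `H²`, so `J g ∈ ker T`. Hence `ker
T† = J (ker T)`, and if `f₀` spans `ker T`, then `J f₀` spans `ker T†`.
-/

noncomputable section

namespace DarkSoliton

open TemperedDistribution FourierTransform LineDeriv
open scoped Real

/-! ### Sobolev regularity on the line -/

theorem besselPotential_two_eq (u : 𝓢'(ℝ, C2)) :
    besselPotential ℝ C2 2 u = u - ((2 * π : ℂ) ^ 2)⁻¹ • distDeriv (distDeriv u) := by
  have h1 : distDeriv (distDeriv u)
      = (-(2 * π : ℂ) ^ 2) • fourierMultiplierCLM C2 (fun x : ℝ ↦ ((x : ℂ) ^ 2)) u := by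
    rw [distDeriv, distDeriv, lineDeriv_eq_fourierMultiplierCLM, lineDeriv_eq_fourierMultiplierCLM,
      map_smul, fourierMultiplierCLM_fourierMultiplierCLM_apply (by fun_prop) (by fun_prop),
      smul_smul]
    congr 1
    · linear_combination (-(2 * π : ℂ) ^ 2) * -Complex.I_sq
    · congr 1
      congr 1
      ext x
      simp [pow_two]
  have h2 : besselPotential ℝ C2 2 u
      = u + fourierMultiplierCLM C2 (fun x : ℝ ↦ ((x : ℂ) ^ 2)) u := by
    have e : (fun x : ℝ ↦ (((1 + ‖x‖ ^ 2) ^ ((2 : ℝ) / 2) : ℝ) : ℂ))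
        = (fun _ : ℝ ↦ (1 : ℂ)) + fun x : ℝ ↦ (x : ℂ) ^ 2 := by
      ext x
      simp
    rw [besselPotential, e, fourierMultiplierCLM_apply,
      smulLeftCLM_add (by fun_prop) (by fun_prop)]
    simp [fourierMultiplierCLM_apply, FourierTransform.fourierInv_add]
  rw [h2, h1, smul_smul]
  have : ((2 * π : ℂ) ^ 2) ≠ 0 := by simp [Real.pi_ne_zero]
  rw [mul_neg, inv_mul_cancel₀ this]
  simp

/-- Elliptic regularity for `∂_ξξ`: if `u` and `∂_ξξ u` are in `H^s`, then `u ∈ H^{s+2}`. -/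
theorem memSobolev_add_two {s : ℝ} {u : 𝓢'(ℝ, C2)} (hu : MemSobolev s 2 u)
    (hu2 : MemSobolev s 2 (distDeriv (distDeriv u))) : MemSobolev (2 + s) 2 u := by
  rw [← memSobolev_besselPotential_iff, besselPotential_two_eq]
  exact hu.sub (hu2.smul _)

theorem memSobolev_zero_coe (f : L2) : MemSobolev 0 2 (f : 𝓢'(ℝ, C2)) :=
  memSobolev_zero_iff.mpr ⟨f, rfl⟩

theorem mem_H2_of_weakDeriv {u v w : L2} (hv : (v : 𝓢'(ℝ, C2)) = distDeriv u)
    (hw : (w : 𝓢'(ℝ, C2)) = distDeriv v) : u ∈ H2 := by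
  have := memSobolev_add_two (memSobolev_zero_coe u)
    (by rw [← hv, ← hw]; exact memSobolev_zero_coe w)
  rw [add_zero] at this
  exact this

/-! ### Constant matrices acting on distributions -/

theorem matrixOp_ae (M : Matrix (Fin 2) (Fin 2) ℂ) (f : L2) :
    matrixOp M f =ᵐ[volume] fun ξ => Matrix.toEuclideanCLM (𝕜 := ℂ) M (f ξ) :=
  ContinuousLinearMap.coeFn_compLpL _ _

theorem integrable_schwartz_smul (φ : 𝓢(ℝ, ℂ)) (f : L2) : Integrable fun ξ => φ ξ • f ξ := by
  have h1 : MemLp (φ : ℝ → ℂ) 2 volume := φ.memLp 2 volume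
  have := (Lp.memLp f).smul (r := 1) h1
  exact memLp_one_iff_integrable.mp this

theorem coe_matrixOp_apply (M : Matrix (Fin 2) (Fin 2) ℂ) (f : L2) (φ : 𝓢(ℝ, ℂ)) :
    (matrixOp M f : 𝓢'(ℝ, C2)) φ = Matrix.toEuclideanCLM (𝕜 := ℂ) M ((f : 𝓢'(ℝ, C2)) φ) := by
  rw [Lp.toTemperedDistribution_apply, Lp.toTemperedDistribution_apply,
    ← ContinuousLinearMap.integral_comp_comm _ (integrable_schwartz_smul φ f)]
  refine integral_congr_ae ?_
  filter_upwards [matrixOp_ae M f] with ξ h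
  rw [h, map_smul]

theorem memSobolev_matrixOp (M : Matrix (Fin 2) (Fin 2) ℂ) {s : ℝ} {f : L2}
    (hf : MemSobolev s 2 (f : 𝓢'(ℝ, C2))) : MemSobolev s 2 (matrixOp M f : 𝓢'(ℝ, C2)) := by
  obtain ⟨g, hg⟩ := hf
  refine ⟨matrixOp M g, ?_⟩
  ext1 φ
  rw [coe_matrixOp_apply, ← hg, besselPotential, fourierMultiplierCLM_apply_apply,
    coe_matrixOp_apply, fourierMultiplierCLM_apply_apply]

theorem distDeriv_matrixOp (M : Matrix (Fin 2) (Fin 2) ℂ) {u v : L2}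
    (h : (v : 𝓢'(ℝ, C2)) = distDeriv u) :
    (matrixOp M v : 𝓢'(ℝ, C2)) = distDeriv (matrixOp M u) := by
  ext1 φ
  rw [coe_matrixOp_apply, h, lineDerivOp_apply_apply, lineDerivOp_apply_apply, coe_matrixOp_apply]

/-! ### Schwartz test functions in `H²` -/

/-- The `ℂ²`-valued test function `ξ ↦ (φ ξ)* c`. With the conjugate, the Hermitian pairing with
it, antilinear in the first slot, evaluates a distribution at `φ` itself; see `inner_testFn`. -/
def testFn (c : C2) : 𝓢(ℝ, ℂ) →L[ℝ] 𝓢(ℝ, C2) :=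
  SchwartzMap.postcompCLM
    ((ContinuousLinearMap.toSpanSingleton ℂ c).restrictScalars ℝ ∘L
      (Complex.conjCLE : ℂ →L[ℝ] ℂ))

theorem testFn_apply (c : C2) (φ : 𝓢(ℝ, ℂ)) (ξ : ℝ) : testFn c φ ξ = conj (φ ξ) • c := rfl

theorem lineDerivOp_postcompCLM {E F : Type*} [NormedAddCommGroup E] [NormedSpace ℝ E]
    [NormedAddCommGroup F] [NormedSpace ℝ F] (L : E →L[ℝ] F) (φ : 𝓢(ℝ, E)) (m : ℝ) :
    lineDerivOp m (SchwartzMap.postcompCLM L φ) = SchwartzMap.postcompCLM L (lineDerivOp m φ) := by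
  ext x
  rw [SchwartzMap.postcompCLM_apply, SchwartzMap.lineDerivOp_apply_eq_fderiv,
    SchwartzMap.lineDerivOp_apply_eq_fderiv]
  have : (SchwartzMap.postcompCLM L φ : ℝ → F) = L ∘ φ := rfl
  rw [this, fderiv_comp x L.differentiableAt φ.differentiableAt]
  simp

/-- A Schwartz function, as an element of `L²`. -/
def schwartzL2 (f : 𝓢(ℝ, C2)) : L2 := f.toLp 2 volume

theorem coe_schwartzL2 (f : 𝓢(ℝ, C2)) :
    (schwartzL2 f : 𝓢'(ℝ, C2)) = SchwartzMap.toTemperedDistributionCLM ℝ C2 volume f :=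
  Lp.toTemperedDistribution_toLp_eq f

theorem schwartzL2_mem_H2 (f : 𝓢(ℝ, C2)) : schwartzL2 f ∈ H2 := by
  have h : MemSobolev 2 2 (schwartzL2 f : 𝓢'(ℝ, C2)) := by
    rw [coe_schwartzL2]
    exact f.memSobolev
  exact h

theorem deriv1_schwartzL2 (f : 𝓢(ℝ, C2)) :
    deriv1 ⟨schwartzL2 f, schwartzL2_mem_H2 f⟩ = schwartzL2 (lineDerivOp (1 : ℝ) f) := by
  apply toTemperedDistribution_injective
  rw [deriv1_spec, coe_schwartzL2, coe_schwartzL2, distDeriv,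
    lineDerivOp_toTemperedDistributionCLM_eq]

theorem deriv2_schwartzL2 (f : 𝓢(ℝ, C2)) :
    deriv2 ⟨schwartzL2 f, schwartzL2_mem_H2 f⟩
      = schwartzL2 (lineDerivOp (1 : ℝ) (lineDerivOp (1 : ℝ) f)) := by
  apply toTemperedDistribution_injective
  rw [deriv2_spec, coe_schwartzL2, coe_schwartzL2, distDeriv, distDeriv,
    lineDerivOp_toTemperedDistributionCLM_eq, lineDerivOp_toTemperedDistributionCLM_eq]

theorem inner_testFn (c : C2) (φ : 𝓢(ℝ, ℂ)) (w : L2) :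
    ⟪schwartzL2 (testFn c φ), w⟫_ℂ = ⟪c, (w : 𝓢'(ℝ, C2)) φ⟫_ℂ := by
  rw [schwartzL2, L2.inner_def, Lp.toTemperedDistribution_apply,
    ← integral_inner (integrable_schwartz_smul φ w)]
  refine integral_congr_ae ?_
  filter_upwards [(testFn c φ).coeFn_toLp 2 volume] with ξ h
  rw [h, testFn_apply, inner_smul_left, inner_smul_right]
  simp

theorem dense_H2 : Dense (H2 : Set L2) := by
  refine (SchwartzMap.denseRange_toLpCLM (F := C2) (E := ℝ) (μ := volume) (p := 2)
    ENNReal.ofNat_ne_top).mono ?_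
  rintro _ ⟨f, rfl⟩
  exact schwartzL2_mem_H2 f

/-! ### Integration by parts, through Plancherel -/

/-- For `u` and `∂_ξ u` in `L²`, the identity `𝓕 (∂_ξ u) = 2πiξ 𝓕 u` of distributions holds almost
everywhere between the `L²` Fourier transforms. -/
theorem fourier_weakDeriv_ae {u v : L2} (h : (v : 𝓢'(ℝ, C2)) = distDeriv u) :
    (𝓕 v : L2) =ᵐ[volume] fun ξ => (2 * π * Complex.I * (ξ : ℂ)) • (𝓕 u : L2) ξ := by
  have hd : ((𝓕 v : L2) : 𝓢'(ℝ, C2))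
      = (2 * π * Complex.I) • smulLeftCLM C2 (fun x : ℝ ↦ ((inner ℝ x (1 : ℝ) : ℝ) : ℂ))
        ((𝓕 u : L2) : 𝓢'(ℝ, C2)) := by
    rw [← Lp.fourier_toTemperedDistribution_eq, h, distDeriv, fourier_lineDerivOp_eq,
      Lp.fourier_toTemperedDistribution_eq]
  have hlu : LocallyIntegrable (𝓕 u : L2) volume := (Lp.memLp _).locallyIntegrable (by norm_num)
  have hlv : LocallyIntegrable (𝓕 v : L2) volume := (Lp.memLp _).locallyIntegrable (by norm_num)
  refine ae_eq_of_integral_contDiff_smul_eq hlv ?_ ?_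
  · have hc : Continuous fun ξ : ℝ => 2 * π * Complex.I * (ξ : ℂ) := by fun_prop
    rw [← locallyIntegrableOn_univ] at hlu ⊢
    exact hlu.continuousOn_smul isOpen_univ.isLocallyClosed hc.continuousOn
  · intro g g_smooth g_cpt
    have hg₁ : HasCompactSupport (Complex.ofRealCLM ∘ g) := g_cpt.comp_left rfl
    have hg₂ : ContDiff ℝ (⊤ : ℕ∞) (Complex.ofRealCLM ∘ g) := by fun_prop
    have := congrArg (fun T : 𝓢'(ℝ, C2) => T (hg₁.toSchwartzMap hg₂)) hd
    simp only [Lp.toTemperedDistribution_apply] at this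
    have hs : ∀ T : 𝓢'(ℝ, C2), ∀ φ, ((2 * π * Complex.I) • T) φ = (2 * π * Complex.I) • T φ :=
      fun _ _ => rfl
    rw [hs, smulLeftCLM_apply_apply, Lp.toTemperedDistribution_apply, ← integral_smul] at this
    have ht : (fun x : ℝ ↦ ((inner ℝ x (1 : ℝ) : ℝ) : ℂ)).HasTemperateGrowth := by fun_prop
    simp only [SchwartzMap.smulLeftCLM_apply_apply ht] at this
    refine this.trans ?_
    refine integral_congr_ae (Filter.Eventually.of_forall fun x => ?_)
    have hx : hg₁.toSchwartzMap hg₂ x = (g x : ℂ) := rfl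

    dsimp only
    rw [hx, ← Complex.coe_smul (g x), smul_smul, smul_smul]
    congr 1
    simp
    ring

/-- `⟪∂_ξ u, v⟫ = -⟪u, ∂_ξ v⟫`: on the Fourier side the symbol `2πiξ` is purely imaginary. -/
theorem inner_weakDeriv {u u' v v' : L2} (hu : (u' : 𝓢'(ℝ, C2)) = distDeriv u)
    (hv : (v' : 𝓢'(ℝ, C2)) = distDeriv v) : ⟪u', v⟫_ℂ = -⟪u, v'⟫_ℂ := by
  rw [← Lp.inner_fourier_eq, ← Lp.inner_fourier_eq u, L2.inner_def, L2.inner_def, ← integral_neg]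
  refine integral_congr_ae ?_
  filter_upwards [fourier_weakDeriv_ae hu, fourier_weakDeriv_ae hv] with ξ h1 h2
  rw [h1, h2, inner_smul_left, inner_smul_right, ← neg_mul]
  congr 1
  simp only [map_mul, Complex.conj_I, Complex.conj_ofReal, map_ofNat]
  ring

/-! ### The antiunitary involution `J f = R σ₁ f*` -/

/-- The antilinear map `v ↦ σ₁ v*` on `ℂ²`. -/
def swapConj : C2 →SL[starRingEnd ℂ] C2 := (Matrix.toEuclideanCLM (𝕜 := ℂ) sigma1).comp conjC2

theorem toEuclideanCLM_apply_two (M : Matrix (Fin 2) (Fin 2) ℂ) (v : C2) (i : Fin 2) :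
    Matrix.toEuclideanCLM (𝕜 := ℂ) M v i = M i 0 * v 0 + M i 1 * v 1 := by
  rw [Matrix.ofLp_toEuclideanCLM]
  simp [Matrix.mulVec, dotProduct, Fin.sum_univ_two]

theorem swapConj_apply_zero (v : C2) : swapConj v 0 = conj (v 1) := by
  rw [swapConj, ContinuousLinearMap.comp_apply, toEuclideanCLM_apply_two]
  simp [sigma1, conjC2]

theorem swapConj_apply_one (v : C2) : swapConj v 1 = conj (v 0) := by
  rw [swapConj, ContinuousLinearMap.comp_apply, toEuclideanCLM_apply_two]
  simp [sigma1, conjC2]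

theorem inner_C2 (v w : C2) : ⟪v, w⟫_ℂ = w 0 * conj (v 0) + w 1 * conj (v 1) := by
  simp [PiLp.inner_apply, Fin.sum_univ_two]

/-- The antiunitary involution `J f = R σ₁ f*` on `L²(ℝ; ℂ²)`. -/
def conjReflect (f : L2) : L2 := reflect (matrixOp sigma1 (conjL2 f))

theorem ae_comp_neg {p : ℝ → Prop} (h : ∀ᵐ ξ, p ξ) : ∀ᵐ ξ : ℝ, p (-ξ) :=
  (Measure.measurePreserving_neg (volume : Measure ℝ)).quasiMeasurePreserving.ae h

theorem conjReflect_ae (f : L2) : conjReflect f =ᵐ[volume] fun ξ => swapConj (f (-ξ)) := by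
  have h1 := ae_comp_neg (matrixOp_ae sigma1 (conjL2 f))
  have h2 := ae_comp_neg (conjC2.coeFn_compLp f)
  filter_upwards [Lp.coeFn_compMeasurePreserving (matrixOp sigma1 (conjL2 f))
    (Measure.measurePreserving_neg (volume : Measure ℝ)), h1, h2] with ξ h h1 h2
  rw [conjReflect, reflect, h, Function.comp_apply, h1, conjL2, h2]
  rfl

theorem conjReflect_conjReflect (f : L2) : conjReflect (conjReflect f) = f := by
  apply Lp.ext
  filter_upwards [conjReflect_ae (conjReflect f), ae_comp_neg (conjReflect_ae f)] with ξ h1 h2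
  rw [h1, h2, neg_neg]
  ext i
  fin_cases i <;> simp [swapConj_apply_zero, swapConj_apply_one]

theorem conjReflect_add (f g : L2) : conjReflect (f + g) = conjReflect f + conjReflect g := by
  apply Lp.ext
  filter_upwards [conjReflect_ae (f + g), conjReflect_ae f, conjReflect_ae g,
    ae_comp_neg (Lp.coeFn_add f g), Lp.coeFn_add (conjReflect f) (conjReflect g)]
    with ξ h h1 h2 h3 h4
  rw [h, h4, h3, Pi.add_apply, Pi.add_apply, h1, h2, map_add]

theorem conjReflect_smul (c : ℂ) (f : L2) : conjReflect (c • f) = conj c • conjReflect f := by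
  apply Lp.ext
  filter_upwards [conjReflect_ae (c • f), conjReflect_ae f,
    ae_comp_neg (Lp.coeFn_smul c f), Lp.coeFn_smul (conj c) (conjReflect f)]
    with ξ h h1 h2 h3
  rw [h, h3, h2, Pi.smul_apply, Pi.smul_apply, h1, map_smulₛₗ]

theorem conjReflect_zero : conjReflect 0 = 0 := by
  simpa using conjReflect_smul 0 0

/-- The Schwartz function `x ↦ conj (φ (-x))`. -/
def schwartzConjNeg (φ : 𝓢(ℝ, ℂ)) : 𝓢(ℝ, ℂ) :=
  SchwartzMap.postcompCLM (𝕜 := ℝ) (Complex.conjCLE : ℂ →L[ℝ] ℂ)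
    (SchwartzMap.compCLMOfContinuousLinearEquiv ℝ (ContinuousLinearEquiv.neg ℝ) φ)

theorem schwartzConjNeg_apply (φ : 𝓢(ℝ, ℂ)) (ξ : ℝ) : schwartzConjNeg φ ξ = conj (φ (-ξ)) := rfl

theorem lineDerivOp_schwartzConjNeg (φ : 𝓢(ℝ, ℂ)) :
    lineDerivOp (1 : ℝ) (schwartzConjNeg φ) = -schwartzConjNeg (lineDerivOp (1 : ℝ) φ) := by
  rw [schwartzConjNeg, lineDerivOp_postcompCLM,
    SchwartzMap.lineDerivOp_compCLMOfContinuousLinearEquiv, schwartzConjNeg]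
  have : (ContinuousLinearEquiv.neg ℝ : ℝ ≃L[ℝ] ℝ) 1 = -1 := rfl
  rw [this, lineDerivOp_left_neg, map_neg, map_neg]

theorem schwartzConjNeg_neg (φ : 𝓢(ℝ, ℂ)) : schwartzConjNeg (-φ) = -schwartzConjNeg φ := by
  rw [schwartzConjNeg, schwartzConjNeg, map_neg, map_neg]

theorem coe_conjReflect_apply (f : L2) (φ : 𝓢(ℝ, ℂ)) :
    (conjReflect f : 𝓢'(ℝ, C2)) φ = swapConj ((f : 𝓢'(ℝ, C2)) (schwartzConjNeg φ)) := by
  rw [Lp.toTemperedDistribution_apply, Lp.toTemperedDistribution_apply,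
    ← ContinuousLinearMap.integral_comp_commSL (by simp) _
      (integrable_schwartz_smul (schwartzConjNeg φ) f),
    ← integral_neg_eq_self]
  refine integral_congr_ae ?_
  filter_upwards [ae_comp_neg (conjReflect_ae f)] with ξ h
  rw [h, map_smulₛₗ, schwartzConjNeg_apply, neg_neg, Complex.conj_conj]

theorem distDeriv_conjReflect {u v : L2} (h : (v : 𝓢'(ℝ, C2)) = distDeriv u) :
    (((-1 : ℂ) • conjReflect v : L2) : 𝓢'(ℝ, C2)) = distDeriv (conjReflect u) := by
  ext1 φ
  have hs : ∀ T : 𝓢'(ℝ, C2), ((-1 : ℂ) • T) φ = (-1 : ℂ) • T φ := fun _ => rfl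
  rw [coe_smul, hs, coe_conjReflect_apply, h, lineDerivOp_apply_apply, lineDerivOp_apply_apply,
    coe_conjReflect_apply, lineDerivOp_schwartzConjNeg, schwartzConjNeg_neg, neg_neg, map_neg,
    map_neg, neg_one_smul]

theorem conjReflect_mem_H2 {u : L2} (hu : u ∈ H2) : conjReflect u ∈ H2 := by
  have h1 := deriv1_spec ⟨u, hu⟩
  have h2 := deriv2_spec ⟨u, hu⟩
  rw [← h1] at h2
  have h3 := distDeriv_conjReflect h2
  refine mem_H2_of_weakDeriv (v := (-1 : ℂ) • conjReflect (deriv1 ⟨u, hu⟩))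
    (w := conjReflect (deriv2 ⟨u, hu⟩)) (distDeriv_conjReflect h1) ?_
  rw [coe_smul, distDeriv, lineDerivOp_smul]
  change _ = (-1 : ℂ) • distDeriv _
  rw [← h3, coe_smul, smul_smul]
  simp

theorem deriv1_conjReflect (u : H2) :
    deriv1 ⟨conjReflect u, conjReflect_mem_H2 u.2⟩ = (-1 : ℂ) • conjReflect (deriv1 u) := by
  apply toTemperedDistribution_injective
  rw [deriv1_spec, distDeriv_conjReflect (deriv1_spec u)]

theorem coe_deriv2 (u : H2) : (deriv2 u : 𝓢'(ℝ, C2)) = distDeriv (deriv1 u) := by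
  rw [deriv2_spec, deriv1_spec]

theorem deriv2_conjReflect (u : H2) :
    deriv2 ⟨conjReflect u, conjReflect_mem_H2 u.2⟩ = conjReflect (deriv2 u) := by
  apply toTemperedDistribution_injective
  have h3 := distDeriv_conjReflect (coe_deriv2 u)
  rw [coe_deriv2, deriv1_conjReflect, coe_smul, distDeriv, lineDerivOp_smul]
  change (-1 : ℂ) • distDeriv _ = _
  rw [← h3, coe_smul, smul_smul]
  simp

/-! ### The operator `σ₂ L₀ + ½ k² σ₂ + Ω` and its zeroth order part -/

theorem inner_sigma2_left (f g : L2) : ⟪matrixOp sigma2 f, g⟫_ℂ = ⟪f, matrixOp sigma2 g⟫_ℂ := by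
  rw [L2.inner_def, L2.inner_def]
  refine integral_congr_ae ?_
  filter_upwards [matrixOp_ae sigma2 f, matrixOp_ae sigma2 g] with ξ h1 h2
  rw [h1, h2]
  simp only [inner_C2, toEuclideanCLM_apply_two, sigma2, Matrix.of_apply, Matrix.cons_val',
    Matrix.cons_val_zero, Matrix.cons_val_one, Matrix.cons_val_fin_one, map_add, map_mul, map_neg,
    Complex.conj_I, map_zero]
  ring

theorem matrixOp_sigma2_sigma2 (f : L2) : matrixOp sigma2 (matrixOp sigma2 f) = f := by
  apply Lp.ext
  filter_upwards [matrixOp_ae sigma2 (matrixOp sigma2 f), matrixOp_ae sigma2 f] with ξ h1 h2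
  rw [h1, h2]
  ext i
  fin_cases i <;> simp [toEuclideanCLM_apply_two, sigma2, ← mul_assoc]

theorem matrixOp_sigma2_conjReflect (f : L2) :
    matrixOp sigma2 (conjReflect f) = conjReflect (matrixOp sigma2 f) := by
  apply Lp.ext
  filter_upwards [matrixOp_ae sigma2 (conjReflect f), ae_comp_neg (matrixOp_ae sigma2 f),
    conjReflect_ae f, conjReflect_ae (matrixOp sigma2 f)] with ξ h1 h2 h3 h4
  rw [h1, h3, h4, h2]
  ext i
  fin_cases i <;>
    simp [toEuclideanCLM_apply_two, sigma2, swapConj_apply_zero, swapConj_apply_one]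

/-- The zeroth order part of `σ₂ L₀ + ½ k² σ₂ + Ω`, a multiplication operator on `L²`. -/
def potential (ν : ℝ) (k Ω : ℂ) (u : L2) : L2 :=
  (1 / 2 * k ^ 2) • matrixOp sigma2 u + Ω • u
    + matrixOp sigma2 (memLp_L0fun ν u 0 0).toLp

/-- The operator `σ₂ L₀ + ½ k² σ₂ + Ω` on `H²`, sorted by the order of the derivatives.
The first order part of `σ₂ L₀` is the scalar `-iκ ∂_ξ`. -/
def eigenFun (ν : ℝ) (k Ω : ℂ) (f : H2) : L2 :=
  (-(1 / 2) : ℂ) • matrixOp sigma2 (deriv2 f) + (-(Complex.I * kappa ν)) • deriv1 f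
    + potential ν k Ω f

theorem eigenOp_apply (ν : ℝ) (k Ω : ℂ) (f : H2) :
    (eigenOp ν k Ω).toFun f = eigenFun ν k Ω f := by
  have e : (eigenOp ν k Ω).toFun f = ((1 / 2 * k ^ 2) • matrixOp sigma2 (f : L2) + Ω • (f : L2))
    + matrixOp sigma2 (memLp_L0fun ν (f : L2) (deriv1 f) (deriv2 f)).toLp := rfl
  have e2 : matrixOp sigma2 (memLp_L0fun ν (f : L2) (deriv1 f) (deriv2 f)).toLp
      = (-(1 / 2) : ℂ) • matrixOp sigma2 (deriv2 f)
      + (-(Complex.I * kappa ν)) • deriv1 f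
      + matrixOp sigma2 (memLp_L0fun ν (f : L2) 0 0).toLp := by
    apply Lp.ext
    set a := memLp_L0fun ν (f : L2) (deriv1 f) (deriv2 f)
    set b := memLp_L0fun ν (f : L2) 0 0
    filter_upwards [Lp.coeFn_add ((-(1 / 2) : ℂ) • matrixOp sigma2 (deriv2 f)
      + (-(Complex.I * kappa ν)) • deriv1 f) (matrixOp sigma2 b.toLp),
      Lp.coeFn_add ((-(1 / 2) : ℂ) • matrixOp sigma2 (deriv2 f))
        ((-(Complex.I * kappa ν)) • deriv1 f),
      Lp.coeFn_smul (-(1 / 2) : ℂ) (matrixOp sigma2 (deriv2 f)),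
      Lp.coeFn_smul (-(Complex.I * kappa ν)) (deriv1 f), matrixOp_ae sigma2 (deriv2 f),
      matrixOp_ae sigma2 a.toLp, matrixOp_ae sigma2 b.toLp, a.coeFn_toLp, b.coeFn_toLp,
      Lp.coeFn_zero C2 2 (volume : Measure ℝ)]
      with ξ h1 h2 h3 h4 h5 h6 h7 h8 h9 h10
    rw [h1, Pi.add_apply, h2, Pi.add_apply, h3, h4, Pi.smul_apply, Pi.smul_apply, h5, h6, h7, h8,
      h9]
    ext i
    fin_cases i <;>
      simp only [L0fun, h10, toEuclideanCLM_apply_two, sigma2, PiLp.add_apply, PiLp.smul_apply,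
        smul_eq_mul, Fin.zero_eta, Fin.mk_one, Matrix.of_apply, Matrix.cons_val',
        Matrix.cons_val_zero, Matrix.cons_val_one, Matrix.cons_val_fin_one, Pi.zero_apply,
        PiLp.zero_apply] <;> ring
  rw [e, e2, eigenFun, potential]
  abel

theorem potential_ae (ν : ℝ) (k Ω : ℂ) (u : L2) :
    potential ν k Ω u =ᵐ[volume] fun ξ => (1 / 2 * k ^ 2) •
      Matrix.toEuclideanCLM (𝕜 := ℂ) sigma2 (u ξ) + Ω • u ξ
        + Matrix.toEuclideanCLM (𝕜 := ℂ) sigma2 (L0fun ν u 0 0 ξ) := by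
  set b := memLp_L0fun ν u 0 0
  filter_upwards [Lp.coeFn_add ((1 / 2 * k ^ 2) • matrixOp sigma2 u + Ω • u)
      (matrixOp sigma2 b.toLp), Lp.coeFn_add ((1 / 2 * k ^ 2) • matrixOp sigma2 u) (Ω • u),
      Lp.coeFn_smul (1 / 2 * k ^ 2) (matrixOp sigma2 u), Lp.coeFn_smul Ω u,
      matrixOp_ae sigma2 u, matrixOp_ae sigma2 b.toLp, b.coeFn_toLp] with ξ h1 h2 h3 h4 h5 h6 h7
  rw [potential, h1, Pi.add_apply, h2, Pi.add_apply, h3, h4, Pi.smul_apply, Pi.smul_apply, h5, h6,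
    h7]
  simp [L0fun]

theorem sech_neg (x : ℝ) : sech (-x) = sech x := by
  rw [sech, sech, Real.cosh_neg]

/-- The zeroth order part `C` satisfies `C† J = J C`: its matrix has `C(ξ)ᵀ σ₁ = σ₁ C(-ξ)`, as
`sech²` is even and `tanh` is odd. -/
theorem inner_potential_conjReflect (ν : ℝ) (k Ω : ℂ) (u w : L2) :
    ⟪potential ν k Ω u, conjReflect w⟫_ℂ = ⟪u, conjReflect (potential ν k Ω w)⟫_ℂ := by
  rw [L2.inner_def, L2.inner_def]
  refine integral_congr_ae ?_
  filter_upwards [potential_ae ν k Ω u, conjReflect_ae w, conjReflect_ae (potential ν k Ω w),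
    ae_comp_neg (potential_ae ν k Ω w)] with ξ h1 h2 h3 h4
  rw [h1, h2, h3, h4]
  simp only [inner_C2, swapConj_apply_zero, swapConj_apply_one, L0fun, toEuclideanCLM_apply_two,
    sigma2, PiLp.add_apply, PiLp.smul_apply, smul_eq_mul, Matrix.of_apply, Matrix.cons_val',
    Matrix.cons_val_zero, Matrix.cons_val_one, Matrix.cons_val_fin_one, Pi.zero_apply,
    PiLp.zero_apply, map_add, map_mul, map_neg, map_sub, Complex.conj_I, Complex.conj_ofReal,
    mul_neg, sech_neg, Real.tanh_neg, Complex.ofReal_neg, map_zero]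
  ring

/-! ### The kernel of the adjoint -/

/-- The identity `T† J = J T` on `H²`, in weak form. -/
theorem inner_eigenFun_conjReflect (ν : ℝ) (k Ω : ℂ) (f u : H2) :
    ⟪eigenFun ν k Ω f, conjReflect u⟫_ℂ
      = ⟪(f : L2), conjReflect (eigenFun ν k Ω u)⟫_ℂ := by
  set v : H2 := ⟨conjReflect u, conjReflect_mem_H2 u.2⟩
  have h1 : ⟪deriv1 f, conjReflect u⟫_ℂ = ⟪(f : L2), conjReflect (deriv1 u)⟫_ℂ := by
    have h := inner_weakDeriv (deriv1_spec f) (deriv1_spec v)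
    rw [deriv1_conjReflect, inner_smul_right] at h
    simpa using h
  have h2 : ⟪matrixOp sigma2 (deriv2 f), conjReflect u⟫_ℂ
      = ⟪(f : L2), conjReflect (matrixOp sigma2 (deriv2 u))⟫_ℂ := by
    have a := inner_weakDeriv (coe_deriv2 f)
      (distDeriv_matrixOp sigma2 (deriv1_spec v))
    have b := inner_weakDeriv (deriv1_spec f) (distDeriv_matrixOp sigma2 (coe_deriv2 v))
    rw [inner_sigma2_left, a, b, neg_neg, deriv2_conjReflect, matrixOp_sigma2_conjReflect]
  rw [eigenFun, eigenFun, conjReflect_add, conjReflect_add, conjReflect_smul,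
    conjReflect_smul, inner_add_left, inner_add_left, inner_add_right, inner_add_right,
    inner_smul_left, inner_smul_left, inner_smul_right, inner_smul_right, h1, h2,
    inner_potential_conjReflect]

/-- Elliptic regularity: an `L²` function orthogonal to the range of `T` is in `H²`. -/
theorem mem_H2_of_orthogonal {ν : ℝ} {k Ω : ℂ} {g : L2}
    (hg : ∀ f : H2, ⟪eigenFun ν k Ω f, g⟫_ℂ = 0) : g ∈ H2 := by
  -- `h` is `C† g`, in the form `J C J g`.
  set h : L2 := conjReflect (potential ν k Ω (conjReflect g)) with hh
  have hC : ∀ f : L2, ⟪potential ν k Ω f, g⟫_ℂ = ⟪f, h⟫_ℂ := fun f => by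
    rw [hh, ← inner_potential_conjReflect, conjReflect_conjReflect]
  -- Orthogonality to `T f` for all Schwartz `f` is the equation `T† g = 0` in distributions.
  have key : distDeriv (distDeriv (matrixOp sigma2 g : 𝓢'(ℝ, C2)))
      = (-(2 * Complex.I * kappa ν)) • distDeriv g + (2 : ℂ) • (h : 𝓢'(ℝ, C2)) := by
    ext1 φ
    refine ext_inner_left ℂ fun c => ?_
    have e := hg ⟨schwartzL2 (testFn c φ), schwartzL2_mem_H2 _⟩
    rw [eigenFun, inner_add_left, inner_add_left, inner_smul_left, inner_smul_left,
      inner_sigma2_left, hC, deriv1_schwartzL2, deriv2_schwartzL2] at e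
    have d : ∀ ψ, lineDerivOp (1 : ℝ) (testFn c ψ) = testFn c (lineDerivOp (1 : ℝ) ψ) :=
      fun ψ => lineDerivOp_postcompCLM _ ψ 1
    rw [d, d, inner_testFn, inner_testFn, inner_testFn] at e
    have s1 : ∀ (a b : ℂ) (S T : 𝓢'(ℝ, C2)) (ψ : 𝓢(ℝ, ℂ)),
        (a • S + b • T) ψ = a • S ψ + b • T ψ := fun _ _ _ _ _ => rfl
    have n1 : lineDerivOp (1 : ℝ) (-lineDerivOp (1 : ℝ) φ)
        = -lineDerivOp (1 : ℝ) (lineDerivOp (1 : ℝ) φ) := lineDerivOp_neg _ _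
    have n2 : (g : 𝓢'(ℝ, C2)) (-lineDerivOp (1 : ℝ) φ)
        = -(g : 𝓢'(ℝ, C2)) (lineDerivOp (1 : ℝ) φ) := map_neg _ _
    rw [s1, lineDerivOp_apply_apply, lineDerivOp_apply_apply, lineDerivOp_apply_apply, n1,
      neg_neg, n2, inner_add_right, inner_smul_right, inner_smul_right,
      inner_neg_right]
    simp only [map_neg, map_div₀, map_mul, map_one, map_ofNat, Complex.conj_I,
      Complex.conj_ofReal] at e
    linear_combination (-2 : ℂ) * e
  set w := matrixOp sigma2 g with hw
  have hgw : g = matrixOp sigma2 w := (matrixOp_sigma2_sigma2 g).symm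
  -- The right-hand side of `key` has order one in `g`, so each use of `memSobolev_add_two` gains
  -- one derivative.
  have step : ∀ s : ℝ, s ≤ 1 → MemSobolev s 2 (g : 𝓢'(ℝ, C2)) →
      MemSobolev (s + 1) 2 (g : 𝓢'(ℝ, C2)) := fun s hs hgs => by
    have h2 : MemSobolev (s - 1) 2 (distDeriv (distDeriv (w : 𝓢'(ℝ, C2)))) := by
      rw [key]
      exact (hgs.lineDerivOp.smul _).add (((memSobolev_zero_coe h).mono (by linarith)).smul _)
    have hw1 := memSobolev_add_two ((memSobolev_matrixOp sigma2 hgs).mono (by linarith)) h2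
    rw [hgw]
    refine memSobolev_matrixOp sigma2 ?_
    convert hw1 using 1
    ring
  have h1 := step 0 (by norm_num) (memSobolev_zero_coe g)
  have h2 := step (0 + 1) (by norm_num) h1
  norm_num at h2
  exact h2

theorem mem_kernel_iff {T : L2 →ₗ.[ℂ] L2} {g : L2} :
    g ∈ kernel T ↔ ∃ h : g ∈ T.domain, T.toFun ⟨g, h⟩ = 0 := by
  simp [kernel]

/-- The kernel of the adjoint is the orthogonal complement of the range. -/
theorem mem_kernel_adjoint_iff {T : L2 →ₗ.[ℂ] L2} (hT : Dense (T.domain : Set L2)) {g : L2} :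
    g ∈ kernel T.adjoint ↔ ∀ f : T.domain, ⟪T.toFun f, g⟫_ℂ = 0 := by
  rw [mem_kernel_iff]
  constructor
  · rintro ⟨h, h0⟩ f
    have := LinearPMap.adjoint_isFormalAdjoint hT ⟨g, h⟩ f
    rw [inner_eq_zero_symm]
    refine this.symm.trans ?_
    change ⟪T.adjoint.toFun ⟨g, h⟩, (f : L2)⟫_ℂ = 0
    rw [h0, inner_zero_left]
  · intro h
    have h' : ∀ f : T.domain, ⟪(0 : L2), (f : L2)⟫_ℂ = ⟪g, T f⟫_ℂ := fun f => by
      rw [inner_zero_left, eq_comm, inner_eq_zero_symm]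
      exact h f
    have hd : g ∈ T.adjoint.domain := T.mem_adjoint_domain_of_exists g ⟨0, h'⟩
    exact ⟨hd, LinearPMap.adjoint_apply_eq hT ⟨g, hd⟩ h'⟩

theorem mem_kernel_eigenOp_iff {ν : ℝ} {k Ω : ℂ} {g : L2} :
    g ∈ kernel (eigenOp ν k Ω) ↔ ∃ h : g ∈ H2, eigenFun ν k Ω ⟨g, h⟩ = 0 := by
  rw [mem_kernel_iff]
  exact exists_congr fun h : g ∈ H2 => Eq.congr_left (eigenOp_apply ν k Ω ⟨g, h⟩)

theorem mem_kernel_adjoint_eigenOp_iff_inner {ν : ℝ} {k Ω : ℂ} {g : L2} :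
    g ∈ kernel (eigenOp ν k Ω).adjoint ↔ ∀ f : H2, ⟪eigenFun ν k Ω f, g⟫_ℂ = 0 := by
  rw [mem_kernel_adjoint_iff (T := eigenOp ν k Ω) dense_H2]
  exact forall_congr' fun f => by rw [eigenOp_apply ν k Ω f]

/-- `ker T† = J (ker T)`, since `J` is an involution. -/
theorem mem_kernel_adjoint_eigenOp_iff {ν : ℝ} {k Ω : ℂ} {g : L2} :
    g ∈ kernel (eigenOp ν k Ω).adjoint ↔ conjReflect g ∈ kernel (eigenOp ν k Ω) := by
  rw [mem_kernel_adjoint_eigenOp_iff_inner, mem_kernel_eigenOp_iff]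
  constructor
  · intro h
    have hg := conjReflect_mem_H2 (mem_H2_of_orthogonal h)
    refine ⟨hg, ?_⟩
    have h0 : conjReflect (eigenFun ν k Ω ⟨conjReflect g, hg⟩) = 0 := by
      refine dense_H2.eq_zero_of_inner_right ℂ fun f hf => ?_
      rw [← inner_eigenFun_conjReflect ν k Ω ⟨f, hf⟩, conjReflect_conjReflect]
      exact h ⟨f, hf⟩
    rw [← conjReflect_conjReflect (eigenFun ν k Ω _), h0, conjReflect_zero]
  · rintro ⟨hg, h0⟩ f
    have := inner_eigenFun_conjReflect ν k Ω f ⟨conjReflect g, hg⟩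
    rwa [h0, conjReflect_zero, inner_zero_right, conjReflect_conjReflect] at this
end DarkSoliton

end

open DarkSoliton in
theorem lemma4p1 (ν : ℝ) (hν0 : 0 < ν) (hν1 : ν ≤ 1) (k Ω₀ : ℂ)
    (hk0 : k ≠ 0) (hkc : k ≠ (kCutoff ν : ℂ)) (hkc' : k ≠ -(kCutoff ν : ℂ))
    (f₀ : L2) (hf₀ : f₀ ≠ 0) (hker : f₀ ∈ kernel (eigenOp ν k Ω₀))
    (hsimple : Module.finrank ℂ (kernel (eigenOp ν k Ω₀)) = 1) :
    Module.finrank ℂ (kernel (eigenOp ν k Ω₀).adjoint) = 1 ∧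
      kernel (eigenOp ν k Ω₀).adjoint =
        Submodule.span ℂ {reflect (matrixOp sigma1 (conjL2 f₀))} := by
  change _ ∧ _ = Submodule.span ℂ {conjReflect f₀}
  have hspan : ∀ u ∈ kernel (eigenOp ν k Ω₀), ∃ c : ℂ, c • f₀ = u := fun u hu => by
    obtain ⟨c, hc⟩ := (finrank_eq_one_iff_of_nonzero' (⟨f₀, hker⟩ : kernel (eigenOp ν k Ω₀))
      (fun h => hf₀ (congrArg Subtype.val h))).mp hsimple ⟨u, hu⟩
    exact ⟨c, congrArg Subtype.val hc⟩
  have hJ : conjReflect f₀ ≠ 0 := fun h =>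
    hf₀ (by rw [← conjReflect_conjReflect f₀, h, conjReflect_zero])
  have heq : kernel (eigenOp ν k Ω₀).adjoint = Submodule.span ℂ {conjReflect f₀} := by
    ext g
    rw [mem_kernel_adjoint_eigenOp_iff, Submodule.mem_span_singleton]
    constructor
    · intro hg
      obtain ⟨c, hc⟩ := hspan _ hg
      exact ⟨conj c, by rw [← conjReflect_smul, hc, conjReflect_conjReflect]⟩
    · rintro ⟨c, rfl⟩
      rw [conjReflect_smul, conjReflect_conjReflect]
      exact Submodule.smul_mem _ _ hker
  exact ⟨by rw [heq, finrank_span_singleton hJ], heq⟩
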